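/- Let $\alpha$ be an infinite cardinal and let $I=\{X : X\subseteq\alpha,\ X \text{ finite}\}$. There is an ultrafilter $U$ on $I$ that contains, for every $X\in I$, the set $\{Y\in I : X\subseteq Y\}$. Every such ultrafilter $U$ is $\alpha$-regular (that is, there is a set $E\subseteq U$ with $|E|=\alpha$ such that each $i\in I$ belongs to only finitely many $e\in E$), and for every non-trivial (i.e. having at least two elements) MV-algebra $\mathbf M=(M;\oplus,\neg,0)$ with $|M|\le\alpha$ the following hold, with the same $U$ for all $\mathbf M$: 1. $\mathbf M$ can be embedded into an MV-algebra of functions (with pointwise operations) from $2^{\alpha}$, the set of all subsets of $\alpha$, to the ultrapower $\bigl(\prod_{X\in I}\mathbb Q\cap[0,1]\bigr)/U$; 2. $\mathbf M$ can be embedded into an MV-algebra of functions (with pointwise operations) from $2^{\alpha}$ to the ultrapower $\bigl(\prod_{X\in I}[0,1]\bigr)/U$. Here $[0,1]$ and $\mathbb Q\cap[0,1]$ carry the standard MV-operations $x\oplus y=\min\{x+y,1\}$ and $\neg x=1-x$, and an embedding is an injective map preserving $\oplus$, $\neg$ and $0$. -/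

import Mathlib

universe u v

open Cardinal Filter

/-- An MV-algebra `(A, ⊕, ¬, 0)`; the constant `1` is `¬ 0`. -/
class MVAlgebra (A : Type*) where
  oplus : A → A → A
  neg : A → A
  zero : A
  oplus_comm : ∀ x y : A, oplus x y = oplus y x
  oplus_assoc : ∀ x y z : A, oplus x (oplus y z) = oplus (oplus x y) z
  oplus_zero : ∀ x : A, oplus x zero = x
  neg_neg : ∀ x : A, neg (neg x) = x
  oplus_one : ∀ x : A, oplus x (neg zero) = neg zero
  oplus_neg_swap : ∀ x y : A,
    oplus (neg (oplus (neg x) y)) y = oplus (neg (oplus (neg y) x)) x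

namespace MVAlgebra

/-- An embedding of MV-algebras: an injective homomorphism. -/
structure IsEmbedding {A B : Type*} [MVAlgebra A] [MVAlgebra B] (f : A → B) : Prop where
  injective : Function.Injective f
  map_oplus : ∀ x y : A, f (oplus x y) = oplus (f x) (f y)
  map_neg : ∀ x : A, f (neg x) = neg (f x)
  map_zero : f (zero : A) = (zero : B)

/-- The MV-algebra on the unit interval of an ordered field:
`x ⊕ y = min (x + y) 1` and `¬ x = 1 - x`. For `K = ℝ` this is the standard MV-algebra `[0, 1]`,
for `K = ℚ` it is `ℚ ∩ [0, 1]`. -/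
instance instIcc (K : Type*) [Field K] [LinearOrder K] [IsStrictOrderedRing K] :
    MVAlgebra (Set.Icc (0 : K) 1) where
  oplus x y := ⟨min (x.1 + y.1) 1, le_min (add_nonneg x.2.1 y.2.1) zero_le_one, min_le_right _ _⟩
  neg x := ⟨1 - x.1, sub_nonneg.2 x.2.2, sub_le_self _ x.2.1⟩
  zero := ⟨0, le_refl 0, zero_le_one⟩
  oplus_comm x y := Subtype.ext (by simp only [add_comm])
  oplus_assoc := by
    rintro ⟨x, hx0, hx1⟩ ⟨y, hy0, hy1⟩ ⟨z, hz0, hz1⟩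
    refine Subtype.ext ?_
    show min (x + min (y + z) 1) 1 = min (min (x + y) 1 + z) 1
    rcases min_cases (y + z) 1 with h | h <;> rcases min_cases (x + y) 1 with h' | h' <;>
      rw [h.1, h'.1] <;>
      [rw [add_assoc]; rw [min_eq_right, min_eq_right]; rw [min_eq_right, min_eq_right];
        rw [min_eq_right, min_eq_right]] <;> linarith [h.2, h'.2]
  oplus_zero x := Subtype.ext (by simpa using x.2.2)
  neg_neg x := Subtype.ext (by simp)
  oplus_one x := Subtype.ext (by simpa using x.2.1)
  oplus_neg_swap := by
    rintro ⟨x, hx0, hx1⟩ ⟨y, hy0, hy1⟩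
    refine Subtype.ext ?_
    show min (1 - min (1 - x + y) 1 + y) 1 = min (1 - min (1 - y + x) 1 + x) 1
    congr 1
    rcases le_total x y with h | h
    · rw [min_eq_right (by linarith : (1 : K) ≤ 1 - x + y),
        min_eq_left (by linarith : 1 - y + x ≤ (1 : K))]; ring
    · rw [min_eq_left (by linarith : 1 - x + y ≤ (1 : K)),
        min_eq_right (by linarith : (1 : K) ≤ 1 - y + x)]; ring

/-- The MV-algebra of all functions from `T` to an MV-algebra `A`, with pointwise operations. -/
instance instFun (T A : Type*) [MVAlgebra A] : MVAlgebra (T → A) where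
  oplus f g := fun t => oplus (f t) (g t)
  neg f := fun t => neg (f t)
  zero := fun _ => zero
  oplus_comm _ _ := funext fun _ => oplus_comm _ _
  oplus_assoc _ _ _ := funext fun _ => oplus_assoc _ _ _
  oplus_zero _ := funext fun _ => oplus_zero _
  neg_neg _ := funext fun _ => neg_neg _
  oplus_one _ := funext fun _ => oplus_one _
  oplus_neg_swap _ _ := funext fun _ => oplus_neg_swap _ _

/-- The ultrapower `(∏_{i ∈ I} A) / U`: functions `I → A`, two of them being identified when
the set on which they agree belongs to `U`. -/
abbrev Ultrapower {I : Type*} (U : Ultrafilter I) (A : Type*) : Type _ :=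
  Germ (U : Filter I) A

/-- The quotient MV-algebra structure on an ultrapower. -/
instance instUltrapower {I : Type*} (U : Ultrafilter I) (A : Type*) [MVAlgebra A] :
    MVAlgebra (Ultrapower U A) where
  oplus := Germ.map₂ oplus
  neg := Germ.map neg
  zero := Germ.const zero
  oplus_comm x y := Germ.inductionOn₂ x y fun f g =>
    congrArg Germ.ofFun (oplus_comm f g)
  oplus_assoc x y z := Germ.inductionOn₃ x y z fun f g h =>
    congrArg Germ.ofFun (oplus_assoc f g h)
  oplus_zero x := Germ.inductionOn x fun f => congrArg Germ.ofFun (oplus_zero f)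
  neg_neg x := Germ.inductionOn x fun f => congrArg Germ.ofFun (neg_neg f)
  oplus_one x := Germ.inductionOn x fun f => congrArg Germ.ofFun (oplus_one f)
  oplus_neg_swap x y := Germ.inductionOn₂ x y fun f g =>
    congrArg Germ.ofFun (oplus_neg_swap f g)

end MVAlgebra

/-- A filter `D` over `I` is `α`-regular: it is proper and there is a set `E ⊆ D` of cardinality
`α` such that each `i ∈ I` belongs to only finitely many `e ∈ E`. -/
def IsRegularFilter {I : Type*} (α : Cardinal) (D : Filter I) : Prop :=
  D.NeBot ∧ ∃ E : Set (Set I), E ⊆ D.sets ∧ #E = α ∧ ∀ i : I, {e ∈ E | i ∈ e}.Finite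

/-- The set `I` of finite subsets of the cardinal `α` (as a set, `α` is the initial ordinal of
that cardinality). -/
abbrev FinSubsets (α : Cardinal) : Type _ := Finset α.ord.ToType

/-- The ultrafilter `U` over the finite subsets of `α` contains all the sets
`{Y | X ⊆ Y}` with `X` a finite subset of `α`. -/
def ContainsCones {α : Cardinal} (U : Ultrafilter (FinSubsets α)) : Prop :=
  ∀ X : FinSubsets α, {Y : FinSubsets α | X ⊆ Y} ∈ U

/-! Prelinearity makes an ideal that is maximal among those avoiding a given `a ≠ 0` prime, so its
quotient is a chain in which `a` survives (`exists_prime_ideal`). A nontrivial chain is the unit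
interval of Chang's ordered group. A finite part of the chain involves only finitely many strict
inequalities in that group; Fourier–Motzkin elimination solves them in ℚ, and dividing by the value
at 1 gives a partial embedding into ℚ ∩ [0,1] (`exists_partial_embedding`).

Once the chain is injected into α, the partial embeddings attached to the finite subsets of α glue
to an embedding into the ultrapower: since U contains the cones, each element lies in the domain for
U-almost every index. Quotients of M inject into α whenever M does, so one U serves every chain.
Each nonzero a ∈ M thus has a homomorphism to the ultrapower that does not kill it, and these
homomorphisms are the coordinates of the embedding; the singletons in 2^α already provide enough of
them. -/

/-! ### Fourier–Motzkin elimination and homomorphisms to ℚ. -/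

section FourierMotzkin

variable {G : Type*} [AddCommGroup G] [LinearOrder G] [IsOrderedAddMonoid G]

/-- A finite system of strict linear inequalities with integer coefficients that is solvable in
some linearly ordered abelian group is solvable in `ℚ`. -/
theorem exists_rat_forall_sum_mul_pos {n : ℕ} (v : Fin n → G) (S : Finset (Fin n → ℤ))
    (hS : ∀ c ∈ S, 0 < ∑ i, c i • v i) :
    ∃ w : Fin n → ℚ, ∀ c ∈ S, 0 < ∑ i, (c i : ℚ) * w i := by
  classical
  induction n with
  | zero => exact ⟨Fin.elim0, fun c hc => absurd (hS c hc) (by simp)⟩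
  | succ n ih =>
    -- For `c 0 > 0 > d 0`, the positive combination `c 0 • d - d 0 • c` of two inequalities
    -- eliminates the first unknown.
    let comb : (Fin (n + 1) → ℤ) × (Fin (n + 1) → ℤ) → Fin n → ℤ := fun p i =>
      p.1 0 * p.2 i.succ - p.2 0 * p.1 i.succ
    let Z := (S.filter fun c => c 0 = 0).image Fin.tail
    let P := S.filter fun c => 0 < c 0
    let N := S.filter fun c => c 0 < 0
    obtain ⟨w, hw⟩ := ih (fun i => v i.succ) (Z ∪ (P ×ˢ N).image comb) (by
      intro c hc
      rcases Finset.mem_union.1 hc with hc | hc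
      · obtain ⟨d, hd, rfl⟩ := Finset.mem_image.1 hc
        obtain ⟨hd, hd0⟩ := Finset.mem_filter.1 hd
        have := hS d hd
        rwa [Fin.sum_univ_succ, hd0, zero_smul, zero_add] at this
      · obtain ⟨⟨c, d⟩, hcd, rfl⟩ := Finset.mem_image.1 hc
        obtain ⟨hc, hd⟩ := Finset.mem_product.1 hcd
        obtain ⟨hc, hc0⟩ := Finset.mem_filter.1 hc
        obtain ⟨hd, hd0⟩ := Finset.mem_filter.1 hd
        have h1 := zsmul_pos (hS d hd) hc0
        have h2 := zsmul_pos (hS c hc) (neg_pos.2 hd0)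
        have h3 := add_pos h1 h2
        rw [Fin.sum_univ_succ, Fin.sum_univ_succ] at h3
        convert h3 using 1
        simp only [comb, sub_smul, mul_smul, Finset.sum_sub_distrib, ← Finset.smul_sum, smul_add,
          neg_smul]
        rw [smul_comm (d 0) (c 0) (v 0)]
        abel)
    let L : (Fin (n + 1) → ℤ) → ℚ := fun c => ∑ i : Fin n, (c i.succ : ℚ) * w i
    -- Inequalities in `P` bound the first unknown from below, those in `N` from above; the combined
    -- inequalities say that every lower bound is less than every upper bound.
    obtain ⟨t, ht1, ht2⟩ := Order.exists_between_finsets (P.image fun c => -L c / c 0)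
      (N.image fun c => -L c / c 0) (by
        intro x hx y hy
        obtain ⟨c, hc, rfl⟩ := Finset.mem_image.1 hx
        obtain ⟨d, hd, rfl⟩ := Finset.mem_image.1 hy
        have h := hw _ (Finset.mem_union_right _
          (Finset.mem_image_of_mem comb (Finset.mk_mem_product hc hd)))
        have hL : ∑ i, (comb (c, d) i : ℚ) * w i = c 0 * L d - d 0 * L c := by
          simp only [comb, L, Finset.mul_sum, ← Finset.sum_sub_distrib]
          refine Finset.sum_congr rfl fun i _ => ?_
          push_cast
          ring
        rw [hL] at h
        have hc0 : (0 : ℚ) < c 0 := by exact_mod_cast (Finset.mem_filter.1 hc).2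
        have hd0 : (d 0 : ℚ) < 0 := by exact_mod_cast (Finset.mem_filter.1 hd).2
        rw [div_lt_iff₀ hc0, div_mul_eq_mul_div, lt_div_iff_of_neg hd0]
        linarith)
    refine ⟨Fin.cons t w, fun c hc => ?_⟩
    rw [Fin.sum_univ_succ]
    simp only [Fin.cons_zero, Fin.cons_succ]
    change 0 < (c 0 : ℚ) * t + L c
    rcases lt_trichotomy (c 0) 0 with h | h | h
    · have := ht2 _ (Finset.mem_image_of_mem _ (Finset.mem_filter.2 ⟨hc, h⟩))
      rw [lt_div_iff_of_neg (by exact_mod_cast h)] at this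
      linarith
    · have := hw _ (Finset.mem_union_left _
        (Finset.mem_image_of_mem _ (Finset.mem_filter.2 ⟨hc, h⟩)))
      rw [h, Int.cast_zero, zero_mul, zero_add]
      exact this
    · have := ht1 _ (Finset.mem_image_of_mem _ (Finset.mem_filter.2 ⟨hc, h⟩))
      rw [div_lt_iff₀ (by exact_mod_cast h)] at this
      linarith

/-- Finitely many positive elements of a linearly ordered abelian group can be kept positive by a
homomorphism to `ℚ` from the subgroup they generate. -/
theorem exists_linearMap_span_rat_pos (S : Finset G) :
    ∃ h : Submodule.span ℤ (S : Set G) →ₗ[ℤ] ℚ,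
      ∀ x, (hx : x ∈ S) → 0 < x → 0 < h ⟨x, Submodule.subset_span hx⟩ := by
  classical
  let H := Submodule.span ℤ (S : Set G)
  -- An ordered group is torsion-free, so this finitely generated subgroup is free.
  let b := Module.finBasis ℤ H
  let T := (S.attach.filter fun x => 0 < x.1).image fun x =>
    (b.repr ⟨x.1, Submodule.subset_span x.2⟩ : Fin _ → ℤ)
  obtain ⟨w, hw⟩ := exists_rat_forall_sum_mul_pos (fun i => (b i : G)) T (by
    intro c hc
    obtain ⟨x, hx, rfl⟩ := Finset.mem_image.1 hc
    have := congrArg (Subtype.val : H → G) (b.sum_repr ⟨x.1, Submodule.subset_span x.2⟩)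
    rw [AddSubmonoidClass.coe_finsetSum] at this
    simp only [Submodule.coe_smul] at this
    rw [this]
    exact (Finset.mem_filter.1 hx).2)
  refine ⟨b.constr ℤ w, fun x hx hpos => ?_⟩
  rw [Module.Basis.constr_apply_fintype]
  simp only [Module.Basis.equivFun_apply, zsmul_eq_mul]
  exact hw _ (Finset.mem_image.2 ⟨⟨x, hx⟩, Finset.mem_filter.2 ⟨Finset.mem_attach _ _, hpos⟩, rfl⟩)

end FourierMotzkin

namespace MVAlgebra

local infixl:65 " ⊕ₘ " => MVAlgebra.oplus
local prefix:max "∼" => MVAlgebra.neg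

/-! ### Arithmetic and natural order of MV-algebras. -/

section Order

variable {A : Type*} [MVAlgebra A]

instance : Std.Commutative (oplus : A → A → A) := ⟨oplus_comm⟩
instance : Std.Associative (oplus : A → A → A) := ⟨fun x y z => (oplus_assoc x y z).symm⟩

/-- The unit `1 = ¬ 0`. -/
def one : A := ∼zero

/-- Truncated subtraction `x ⊖ y = ¬ (¬ x ⊕ y)`. -/
def sub (x y : A) : A := ∼(∼x ⊕ₘ y)

/-- The Łukasiewicz product `x ⊙ y = ¬ (¬ x ⊕ ¬ y)`. -/
def odot (x y : A) : A := ∼(∼x ⊕ₘ ∼y)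

local infixl:65 " ⊖ " => MVAlgebra.sub
local infixl:70 " ⊙ " => MVAlgebra.odot

theorem neg_one : ∼(one : A) = zero := neg_neg _

theorem oplus_one' (x : A) : x ⊕ₘ one = one := oplus_one x

theorem one_oplus (x : A) : one ⊕ₘ x = one := by rw [oplus_comm, oplus_one']

theorem zero_oplus (x : A) : zero ⊕ₘ x = x := by rw [oplus_comm, oplus_zero]

theorem neg_injective : Function.Injective (neg : A → A) := fun x y h => by
  rw [← neg_neg x, h, neg_neg]

theorem neg_oplus_self (x : A) : ∼x ⊕ₘ x = one := by
  have h := oplus_neg_swap x one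
  rwa [oplus_one', neg_one, zero_oplus, eq_comm] at h

theorem oplus_neg_self (x : A) : x ⊕ₘ ∼x = one := by rw [oplus_comm, neg_oplus_self]

theorem sub_oplus_comm (x y : A) : (x ⊖ y) ⊕ₘ y = (y ⊖ x) ⊕ₘ x := oplus_neg_swap x y

theorem sub_oplus_of_neg_oplus {x y : A} (h : ∼x ⊕ₘ y = one) : (y ⊖ x) ⊕ₘ x = y := by
  rw [sub_oplus_comm, sub, h, neg_one, zero_oplus]

theorem neg_oplus_eq_one_iff {x y : A} : ∼x ⊕ₘ y = one ↔ ∃ z, x ⊕ₘ z = y := by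
  constructor
  · intro h
    exact ⟨y ⊖ x, by rw [oplus_comm, sub_oplus_of_neg_oplus h]⟩
  · rintro ⟨z, rfl⟩
    rw [oplus_assoc, neg_oplus_self, one_oplus]

/-- The natural order of an MV-algebra: `x ≤ y` when `¬ x ⊕ y = 1`. -/
@[reducible]
def natOrder (A : Type*) [MVAlgebra A] : PartialOrder A where
  le x y := ∼x ⊕ₘ y = one
  le_refl := neg_oplus_self
  le_trans x y z hxy hyz := by
    obtain ⟨a, rfl⟩ := neg_oplus_eq_one_iff.1 hxy
    obtain ⟨b, rfl⟩ := neg_oplus_eq_one_iff.1 hyz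
    exact neg_oplus_eq_one_iff.2 ⟨a ⊕ₘ b, oplus_assoc _ _ _⟩
  le_antisymm x y hxy hyx := by
    have h := sub_oplus_of_neg_oplus hxy
    rwa [sub, hyx, neg_one, zero_oplus] at h

attribute [local instance] natOrder

theorem le_def {x y : A} : x ≤ y ↔ ∼x ⊕ₘ y = one := Iff.rfl

theorem le_oplus_left (x y : A) : x ≤ x ⊕ₘ y := neg_oplus_eq_one_iff.2 ⟨y, rfl⟩

theorem le_oplus_right (x y : A) : y ≤ x ⊕ₘ y := by rw [oplus_comm]; exact le_oplus_left y x

theorem zero_le' (x : A) : zero ≤ x := neg_oplus_eq_one_iff.2 ⟨x, zero_oplus x⟩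

theorem le_one' (x : A) : x ≤ one := oplus_one' _

theorem eq_zero_of_le_zero {x : A} (h : x ≤ zero) : x = zero := le_antisymm h (zero_le' x)

theorem eq_one_of_one_le {x : A} (h : one ≤ x) : x = one := le_antisymm (le_one' x) h

theorem sub_oplus_cancel {x y : A} (h : x ≤ y) : (y ⊖ x) ⊕ₘ x = y := sub_oplus_of_neg_oplus h

theorem neg_le_neg' {x y : A} (h : x ≤ y) : ∼y ≤ ∼x := by
  rw [le_def, neg_neg, oplus_comm]; exact h

theorem oplus_le_oplus {x y z w : A} (h : x ≤ y) (h' : z ≤ w) : x ⊕ₘ z ≤ y ⊕ₘ w := by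
  obtain ⟨a, rfl⟩ := neg_oplus_eq_one_iff.1 h
  obtain ⟨b, rfl⟩ := neg_oplus_eq_one_iff.1 h'
  exact neg_oplus_eq_one_iff.2 ⟨a ⊕ₘ b, by ac_rfl⟩

theorem sub_le_iff {x y z : A} : x ⊖ y ≤ z ↔ x ≤ y ⊕ₘ z := by
  rw [le_def, le_def, sub, neg_neg, oplus_assoc]

theorem odot_le_iff {x y z : A} : x ⊙ y ≤ z ↔ x ≤ ∼y ⊕ₘ z := by
  rw [le_def, le_def, odot, neg_neg, oplus_assoc]

theorem le_oplus_sub (x y : A) : x ≤ y ⊕ₘ (x ⊖ y) := sub_le_iff.1 le_rfl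

theorem sub_le_self' (x y : A) : x ⊖ y ≤ x := sub_le_iff.2 (le_oplus_right _ _)

theorem sub_eq_zero_iff {x y : A} : x ⊖ y = zero ↔ x ≤ y := by
  rw [← oplus_zero y, ← sub_le_iff, oplus_zero]
  exact ⟨fun h => h.le, eq_zero_of_le_zero⟩

theorem odot_comm (x y : A) : x ⊙ y = y ⊙ x := by rw [odot, odot, oplus_comm]

theorem odot_assoc (x y z : A) : x ⊙ (y ⊙ z) = x ⊙ y ⊙ z := by
  simp only [odot, neg_neg, oplus_assoc]

theorem odot_neg (x y : A) : x ⊙ ∼y = x ⊖ y := by rw [odot, sub, neg_neg]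

theorem odot_le_left (x y : A) : x ⊙ y ≤ x := odot_le_iff.2 (le_oplus_right _ _)

theorem odot_le_right (x y : A) : x ⊙ y ≤ y := by rw [odot_comm]; exact odot_le_left y x

theorem odot_le_odot {x y z w : A} (h : x ≤ y) (h' : z ≤ w) : x ⊙ z ≤ y ⊙ w :=
  neg_le_neg' (oplus_le_oplus (neg_le_neg' h) (neg_le_neg' h'))

theorem odot_one (x : A) : x ⊙ one = x := by rw [odot, neg_one, oplus_zero, neg_neg]

theorem one_odot (x : A) : one ⊙ x = x := by rw [odot_comm, odot_one]

theorem odot_neg_self (x : A) : x ⊙ ∼x = zero := by rw [odot_neg, sub_eq_zero_iff]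

theorem odot_eq_zero_iff {x y : A} : x ⊙ y = zero ↔ x ≤ ∼y := by
  rw [← oplus_zero ∼y, ← odot_le_iff]
  exact ⟨fun h => h.le, eq_zero_of_le_zero⟩

theorem oplus_eq_one_iff {x y : A} : x ⊕ₘ y = one ↔ ∼x ≤ y := by rw [le_def, neg_neg]

/-- `(x ⊕ w) ⊖ w = x` as soon as `x ≤ ¬ w`. -/
theorem oplus_sub_cancel {x w : A} (h : x ≤ ∼w) : (x ⊕ₘ w) ⊖ w = x := by
  have h1 := sub_oplus_cancel (neg_le_neg' h)
  rw [neg_neg] at h1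
  apply neg_injective
  rw [sub, neg_neg, ← h1, sub, neg_neg]

theorem oplus_right_cancel {x y w : A} (hx : x ≤ ∼w) (hy : y ≤ ∼w) (h : x ⊕ₘ w = y ⊕ₘ w) :
    x = y := by
  rw [← oplus_sub_cancel hx, h, oplus_sub_cancel hy]

/-- The two expressions of the meet agree. -/
theorem sub_sub_comm (x y : A) : x ⊖ (x ⊖ y) = y ⊖ (y ⊖ x) := by
  have h := oplus_neg_swap ∼y ∼x
  rw [neg_neg, neg_neg] at h
  simp only [sub]
  rw [oplus_comm ∼x, oplus_comm ∼x, oplus_comm ∼y, oplus_comm ∼y x]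
  rw [oplus_comm y, oplus_comm x] at h
  rw [oplus_comm y, oplus_comm x, h]

/-- `x ⊖ (x ⊖ y)` is the meet of `x` and `y`. The map `x ⊖ (x ⊖ ·)` is monotone, and it fixes every
`z ≤ x` by symmetry of the meet. -/
theorem le_sub_sub {x y z : A} (hx : z ≤ x) (hy : z ≤ y) : z ≤ x ⊖ (x ⊖ y) := by
  have h : z = z ⊖ (z ⊖ x) := by
    rw [sub_eq_zero_iff.2 hx, sub, oplus_zero, neg_neg]
  have mono : ∀ {a b c : A}, a ≤ b → c ⊖ (c ⊖ a) ≤ c ⊖ (c ⊖ b) := fun hab =>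
    neg_le_neg' (oplus_le_oplus le_rfl (neg_le_neg' (oplus_le_oplus le_rfl hab)))
  calc z = x ⊖ (x ⊖ z) := by rw [sub_sub_comm, ← h]
    _ ≤ _ := mono hy

/-- Prelinearity: `x ⊖ y` and `y ⊖ x` are disjoint. -/
theorem eq_zero_of_le_sub_of_le_sub {x y z : A} (h1 : z ≤ x ⊖ y) (h2 : z ≤ y ⊖ x) :
    z = zero := by
  set m := x ⊖ (x ⊖ y) with hm
  have hx : m ⊕ₘ (x ⊖ y) = x := sub_oplus_cancel (sub_le_self' x y)
  have hy : m ⊕ₘ (y ⊖ x) = y := by rw [hm, sub_sub_comm]; exact sub_oplus_cancel (sub_le_self' y x)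
  -- Adding `z` to the meet `m` stays below both `x` and `y`, hence below `m`; as `z ≤ ¬m`, no
  -- truncation occurs and `m` cancels.
  have hzm : z ⊕ₘ m ≤ m := by
    refine le_sub_sub ?_ ?_
    · calc z ⊕ₘ m ≤ (x ⊖ y) ⊕ₘ m := oplus_le_oplus h1 le_rfl
        _ = x := by rw [oplus_comm, hx]
    · calc z ⊕ₘ m ≤ (y ⊖ x) ⊕ₘ m := oplus_le_oplus h2 le_rfl
        _ = y := by rw [oplus_comm, hy]
  have hz : z ≤ ∼m := by
    have : m ≤ ∼(x ⊖ y) := by rw [hm, ← odot_neg]; exact odot_le_right _ _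
    exact h1.trans (by simpa only [neg_neg] using neg_le_neg' this)
  rw [← oplus_sub_cancel hz, sub_eq_zero_iff]
  exact hzm

end Order

/-- An MV-homomorphism. -/
structure IsHom {A B : Type*} [MVAlgebra A] [MVAlgebra B] (f : A → B) : Prop where
  map_oplus : ∀ x y : A, f (x ⊕ₘ y) = f x ⊕ₘ f y
  map_neg : ∀ x : A, f ∼x = ∼(f x)
  map_zero : f (zero : A) = (zero : B)

theorem IsHom.map_sub {A B : Type*} [MVAlgebra A] [MVAlgebra B] {f : A → B} (hf : IsHom f)
    (x y : A) : f (sub x y) = sub (f x) (f y) := by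
  rw [sub, sub, hf.map_neg, hf.map_oplus, hf.map_neg]

/-! ### Prime ideals and quotients. -/

section PrimeIdeals

variable {A : Type*} [MVAlgebra A]

attribute [local instance] natOrder

local infixl:65 " ⊖ " => MVAlgebra.sub

/-- An ideal of an MV-algebra. -/
structure IsIdeal (J : Set A) : Prop where
  zero_mem : zero ∈ J
  oplus_mem : ∀ {x y}, x ∈ J → y ∈ J → x ⊕ₘ y ∈ J
  mem_of_le : ∀ {x y}, x ≤ y → y ∈ J → x ∈ J

theorem isIdeal_singleton_zero : IsIdeal ({zero} : Set A) where
  zero_mem := rfl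
  oplus_mem := by rintro x y rfl rfl; exact oplus_zero _
  mem_of_le := by rintro x y h rfl; exact eq_zero_of_le_zero h

theorem iterate_oplus (p x y : A) (n : ℕ) : (p ⊕ₘ ·)^[n] x ⊕ₘ y = (p ⊕ₘ ·)^[n] (x ⊕ₘ y) := by
  induction n with
  | zero => rfl
  | succ n ih => simp only [Function.iterate_succ_apply', ← ih, oplus_assoc]

theorem iterate_oplus_iterate (p x y : A) (m n : ℕ) :
    (p ⊕ₘ ·)^[m] x ⊕ₘ (p ⊕ₘ ·)^[n] y = (p ⊕ₘ ·)^[m + n] (x ⊕ₘ y) := by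
  rw [iterate_oplus, oplus_comm, iterate_oplus, ← Function.iterate_add_apply, oplus_comm]

/-- Disjoint `p`, `q` have disjoint multiples, in a form relative to `c`. If `a` is below both `c ⊕
p` and `c ⊕ q`, then `a ⊖ c` is below `p` and `q`, so it vanishes; copies of `p`, then of `q`, are
removed one at a time this way. -/
theorem le_of_le_iterate_oplus {p q : A} (h : ∀ z, z ≤ p → z ≤ q → z = zero) {a c : A} {m n : ℕ}
    (hp : a ≤ (p ⊕ₘ ·)^[m] c) (hq : a ≤ (q ⊕ₘ ·)^[n] c) : a ≤ c := by
  have step : ∀ {p q : A}, (∀ z, z ≤ p → z ≤ q → z = zero) → ∀ {c : A}, a ≤ c ⊕ₘ p → a ≤ c ⊕ₘ q →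
      a ≤ c := fun h c hp hq => sub_eq_zero_iff.1 (h _ (sub_le_iff.2 hp) (sub_le_iff.2 hq))
  have mono : ∀ (p q c : A) (m : ℕ), a ≤ c ⊕ₘ q → a ≤ (p ⊕ₘ ·)^[m] c ⊕ₘ q := by
    intro p q c m hc
    induction m with
    | zero => exact hc
    | succ m ih =>
      rw [Function.iterate_succ_apply', ← oplus_assoc]
      exact ih.trans (le_oplus_right _ _)
  have one_step : ∀ (p q : A), (∀ z, z ≤ p → z ≤ q → z = zero) → ∀ (m : ℕ) (c : A),
      a ≤ (p ⊕ₘ ·)^[m] c → a ≤ c ⊕ₘ q → a ≤ c := by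
    intro p q h m c hp hq
    induction m with
    | zero => exact hp
    | succ m ih =>
      refine ih (step h ?_ (mono p q c m hq))
      rwa [Function.iterate_succ_apply', oplus_comm] at hp
  induction n with
  | zero => exact hq
  | succ n ih =>
    refine ih (one_step p q h m _ ?_ ?_)
    · have hle : c ≤ (q ⊕ₘ ·)^[n] c := by
        clear * -
        induction n with
        | zero => exact le_rfl
        | succ n ih => rw [Function.iterate_succ_apply']; exact ih.trans (le_oplus_right _ _)
      refine hp.trans ?_
      rw [← sub_oplus_cancel hle, oplus_comm, ← iterate_oplus]
      exact le_oplus_left _ _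
    · rwa [Function.iterate_succ_apply', oplus_comm] at hq

theorem IsIdeal.isIdeal_adjoin {J : Set A} (hJ : IsIdeal J) (p : A) :
    IsIdeal {w | ∃ j ∈ J, ∃ n : ℕ, w ≤ (p ⊕ₘ ·)^[n] j} where
  zero_mem := ⟨zero, hJ.zero_mem, 0, le_rfl⟩
  oplus_mem := by
    rintro x y ⟨j, hj, m, hx⟩ ⟨k, hk, n, hy⟩
    refine ⟨j ⊕ₘ k, hJ.oplus_mem hj hk, m + n, ?_⟩
    rw [← iterate_oplus_iterate]
    exact oplus_le_oplus hx hy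
  mem_of_le := by
    rintro x y h ⟨j, hj, m, hy⟩
    exact ⟨j, hj, m, h.trans hy⟩

/-- Every nonzero element avoids some prime ideal. -/
theorem exists_prime_ideal {a : A} (ha : a ≠ zero) :
    ∃ J : Set A, IsIdeal J ∧ a ∉ J ∧ ∀ x y, x ⊖ y ∈ J ∨ y ⊖ x ∈ J := by
  obtain ⟨J, -, hmax⟩ := zorn_subset_nonempty {J : Set A | IsIdeal J ∧ a ∉ J} (by
    rintro c hc hchain ⟨K, hK⟩
    refine ⟨⋃₀ c, ⟨⟨⟨K, hK, (hc hK).1.zero_mem⟩, ?_, ?_⟩, ?_⟩, fun s hs =>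
      Set.subset_sUnion_of_mem hs⟩
    · rintro x y ⟨S, hS, hx⟩ ⟨T, hT, hy⟩
      rcases hchain.total hS hT with h | h
      · exact ⟨T, hT, (hc hT).1.oplus_mem (h hx) hy⟩
      · exact ⟨S, hS, (hc hS).1.oplus_mem hx (h hy)⟩
    · rintro x y h ⟨S, hS, hy⟩
      exact ⟨S, hS, (hc hS).1.mem_of_le h hy⟩
    · rintro ⟨S, hS, h⟩
      exact (hc hS).2 h) {zero} ⟨isIdeal_singleton_zero, ha⟩
  obtain ⟨hJ, haJ⟩ := hmax.prop
  -- By maximality, the ideal generated by `J` and `p` must contain `a`.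
  have key : ∀ p, p ∉ J → ∃ j ∈ J, ∃ n : ℕ, a ≤ (p ⊕ₘ ·)^[n] j := by
    intro p hp
    by_contra hcon
    exact hp (hmax.le_of_ge (y := {w | ∃ j ∈ J, ∃ n : ℕ, w ≤ (p ⊕ₘ ·)^[n] j})
      ⟨hJ.isIdeal_adjoin p, hcon⟩ (fun j hj => ⟨j, hj, 0, le_rfl⟩)
      ⟨zero, hJ.zero_mem, 1, le_oplus_left _ _⟩)
  refine ⟨J, hJ, haJ, fun x y => ?_⟩
  by_contra! h
  obtain ⟨j, hj, m, hm⟩ := key _ h.1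
  obtain ⟨k, hk, n, hn⟩ := key _ h.2
  refine haJ (hJ.mem_of_le (le_of_le_iterate_oplus (c := j ⊕ₘ k) (m := m) (n := n)
    (p := x ⊖ y) (q := y ⊖ x)
    (fun _ => eq_zero_of_le_sub_of_le_sub) ?_ ?_) (hJ.oplus_mem hj hk))
  · rw [← iterate_oplus]; exact hm.trans (le_oplus_left _ _)
  · rw [oplus_comm, ← iterate_oplus]; exact hn.trans (le_oplus_left _ _)

/-- Congruence modulo an ideal. -/
def IsIdeal.setoid {J : Set A} (hJ : IsIdeal J) : Setoid A where
  r x y := x ⊖ y ∈ J ∧ y ⊖ x ∈ J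
  iseqv :=
    { refl := fun x => by
        have : x ⊖ x = zero := sub_eq_zero_iff.2 le_rfl
        simp only [this, hJ.zero_mem, and_self]
      symm := fun h => ⟨h.2, h.1⟩
      trans := by
        have key : ∀ {x y z : A}, x ⊖ y ∈ J → y ⊖ z ∈ J → x ⊖ z ∈ J := by
          intro x y z h h'
          refine hJ.mem_of_le (sub_le_iff.2 ?_) (hJ.oplus_mem h h')
          calc x ≤ y ⊕ₘ (x ⊖ y) := le_oplus_sub _ _
            _ ≤ (z ⊕ₘ (y ⊖ z)) ⊕ₘ (x ⊖ y) := oplus_le_oplus (le_oplus_sub _ _) le_rfl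
            _ = z ⊕ₘ ((x ⊖ y) ⊕ₘ (y ⊖ z)) := by ac_rfl
        exact fun {_ _ _} h h' => ⟨key h.1 h'.1, key h'.2 h.2⟩ }

/-- The quotient of an MV-algebra by an ideal. -/
def IsIdeal.Quot {J : Set A} (hJ : IsIdeal J) : Type _ := Quotient hJ.setoid

/-- The quotient map. -/
def IsIdeal.toQuot {J : Set A} (hJ : IsIdeal J) (x : A) : hJ.Quot := Quotient.mk hJ.setoid x

theorem IsIdeal.toQuot_surjective {J : Set A} (hJ : IsIdeal J) : Function.Surjective hJ.toQuot :=
  Quotient.mk_surjective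

theorem oplus_sub_oplus_le (x y z w : A) : (x ⊕ₘ y) ⊖ (z ⊕ₘ w) ≤ (x ⊖ z) ⊕ₘ (y ⊖ w) := by
  refine sub_le_iff.2 ((oplus_le_oplus (le_oplus_sub x z) (le_oplus_sub y w)).trans_eq ?_)
  ac_rfl

theorem neg_sub_neg' (x y : A) : ∼x ⊖ ∼y = y ⊖ x := by
  rw [sub, sub, neg_neg, oplus_comm]

instance IsIdeal.instMVAlgebraQuot {J : Set A} (hJ : IsIdeal J) : MVAlgebra hJ.Quot where
  oplus := Quotient.map₂ oplus fun _ _ h _ _ h' =>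
    ⟨hJ.mem_of_le (oplus_sub_oplus_le _ _ _ _) (hJ.oplus_mem h.1 h'.1),
      hJ.mem_of_le (oplus_sub_oplus_le _ _ _ _) (hJ.oplus_mem h.2 h'.2)⟩
  neg := Quotient.map neg fun x y h => by
    refine ⟨?_, ?_⟩
    · rw [neg_sub_neg']; exact h.2
    · rw [neg_sub_neg']; exact h.1
  zero := Quotient.mk _ zero
  oplus_comm := by rintro ⟨x⟩ ⟨y⟩; exact congrArg _ (oplus_comm x y)
  oplus_assoc := by rintro ⟨x⟩ ⟨y⟩ ⟨z⟩; exact congrArg _ (oplus_assoc x y z)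
  oplus_zero := by rintro ⟨x⟩; exact congrArg _ (oplus_zero x)
  neg_neg := by rintro ⟨x⟩; exact congrArg _ (neg_neg x)
  oplus_one := by rintro ⟨x⟩; exact congrArg _ (oplus_one x)
  oplus_neg_swap := by rintro ⟨x⟩ ⟨y⟩; exact congrArg _ (oplus_neg_swap x y)

theorem IsIdeal.isHom_toQuot {J : Set A} (hJ : IsIdeal J) :
    IsHom hJ.toQuot :=
  ⟨fun _ _ => rfl, fun _ => rfl, rfl⟩

theorem IsIdeal.toQuot_eq_zero_iff {J : Set A} (hJ : IsIdeal J) {x : A} :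
    hJ.toQuot x = zero ↔ x ∈ J := by
  refine Quotient.eq.trans ⟨fun h => ?_, fun h => ⟨hJ.mem_of_le (sub_le_self' _ _) h, ?_⟩⟩
  · refine hJ.mem_of_le ?_ h.1
    exact (le_oplus_sub x zero).trans_eq (zero_oplus _)
  · exact hJ.mem_of_le (sub_le_self' _ _) hJ.zero_mem

theorem IsIdeal.toQuot_le_toQuot {J : Set A} (hJ : IsIdeal J) {x y : A} (h : x ⊖ y ∈ J) :
    hJ.toQuot x ≤ hJ.toQuot y := by
  rw [← sub_eq_zero_iff]
  exact hJ.toQuot_eq_zero_iff.2 h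

end PrimeIdeals

/-! ### Chang's ordered group of an MV-chain. -/

section ChangGroup

attribute [local instance] natOrder

local infixl:65 " ⊖ " => MVAlgebra.sub
local infixl:70 " ⊙ " => MVAlgebra.odot

/-- An MV-chain: an MV-algebra whose natural order is total. -/
class IsMVChain (A : Type*) [MVAlgebra A] : Prop where
  le_total : ∀ x y : A, x ≤ y ∨ y ≤ x

variable {A : Type*} [MVAlgebra A]

theorem odot_eq_zero_of_oplus_ne_one [IsMVChain A] {x y : A} (h : x ⊕ₘ y ≠ one) :
    x ⊙ y = zero := by
  rw [odot_comm, odot_eq_zero_iff]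
  exact (IsMVChain.le_total y ∼x).resolve_right fun h' => h (oplus_eq_one_iff.2 h')

theorem odot_oplus_neg {x z : A} (h : x ⊕ₘ z = one) : (x ⊙ z) ⊕ₘ ∼z = x := by
  have h1 : x ⊙ z = x ⊖ ∼z := by rw [← odot_neg, neg_neg]
  rw [h1]
  rw [oplus_comm] at h
  exact sub_oplus_cancel (oplus_eq_one_iff.1 h)

/-- Read in an interval, both sides are `max (x + y + z - 1) 0`. When the total sum reaches 1,
adding `¬z` to either side gives `x ⊕ y`; otherwise both vanish. -/
theorem oplus_odot_comm_of_odot_eq_zero [IsMVChain A] {x y z : A} (hxy : x ⊙ y = zero)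
    (hyz : y ⊙ z = zero) : (x ⊕ₘ y) ⊙ z = (y ⊕ₘ z) ⊙ x := by
  by_cases ha : x ⊕ₘ y ⊕ₘ z = one
  · have ha' : x ⊕ₘ (y ⊕ₘ z) = one := by rw [oplus_assoc, ha]
    refine oplus_right_cancel (w := ∼z) ?_ ?_ ?_
    · rw [neg_neg]; exact odot_le_right _ _
    · rw [neg_neg, odot_le_iff]
      refine oplus_le_oplus ?_ le_rfl
      rw [← odot_eq_zero_iff, odot_comm, hxy]
    · have hz : ∼z = ∼(y ⊕ₘ z) ⊕ₘ y := by
        rw [← sub_oplus_cancel (odot_eq_zero_iff.1 hyz), sub, neg_neg, oplus_comm z]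
      rw [odot_oplus_neg ha, hz, oplus_assoc, odot_comm, odot_oplus_neg ha']
  · rw [odot_eq_zero_of_oplus_ne_one ha, odot_eq_zero_of_oplus_ne_one]
    intro h
    exact ha (by rw [← h]; ac_rfl)

theorem odot_oplus_comm_of_oplus_eq_one [IsMVChain A] {x y z : A} (hxy : x ⊕ₘ y = one)
    (hyz : y ⊕ₘ z = one) : (x ⊙ y) ⊕ₘ z = (y ⊙ z) ⊕ₘ x := by
  have h := oplus_odot_comm_of_odot_eq_zero (x := ∼x) (y := ∼y) (z := ∼z)
    (by rw [odot, neg_neg, neg_neg, hxy, neg_one]) (by rw [odot, neg_neg, neg_neg, hyz, neg_one])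
  apply neg_injective
  simpa only [odot, neg_neg] using h

theorem odot_oplus_eq_oplus_odot {x y z : A} (hxy : x ⊕ₘ y = one)
    (hyz : y ⊙ z = zero) : (x ⊙ y) ⊕ₘ z = (y ⊕ₘ z) ⊙ x := by
  have hx : x ⊕ₘ (y ⊕ₘ z) = one := by rw [oplus_assoc, hxy, one_oplus]
  refine oplus_right_cancel (w := ∼(y ⊕ₘ z)) ?_ ?_ ?_
  · rw [neg_neg]; exact oplus_le_oplus (odot_le_right _ _) le_rfl
  · rw [neg_neg]; exact odot_le_left _ _
  · have hz : z ⊕ₘ ∼(y ⊕ₘ z) = ∼y := by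
      rw [odot_comm, odot_eq_zero_iff] at hyz
      rw [oplus_comm, ← sub_oplus_cancel hyz, sub, neg_neg, oplus_comm y]
    rw [← oplus_assoc, hz, odot_oplus_neg hxy, odot_comm _ x, odot_oplus_neg hx]

/-- Both sides represent `x + y + z - 1` truncated to the unit interval. This symmetry is what makes
addition with carry associative. -/
theorem carry_rotate [IsMVChain A] (x y z : A) :
    (x ⊙ y) ⊕ₘ ((x ⊕ₘ y) ⊙ z) = (y ⊙ z) ⊕ₘ ((y ⊕ₘ z) ⊙ x) := by
  by_cases hxy : x ⊕ₘ y = one <;> by_cases hyz : y ⊕ₘ z = one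
  · rw [hxy, hyz, one_odot, one_odot, odot_oplus_comm_of_oplus_eq_one hxy hyz]
  · have h := odot_eq_zero_of_oplus_ne_one hyz
    rw [hxy, one_odot, odot_oplus_eq_oplus_odot hxy h, h, zero_oplus]
  · have h := odot_eq_zero_of_oplus_ne_one hxy
    rw [hyz, one_odot, h, zero_oplus, odot_comm y z, odot_oplus_eq_oplus_odot
      (by rw [oplus_comm, hyz]) (by rw [odot_comm, h]), oplus_comm y x]
  · have h := odot_eq_zero_of_oplus_ne_one hxy
    have h' := odot_eq_zero_of_oplus_ne_one hyz
    rw [h, h', zero_oplus, zero_oplus, oplus_odot_comm_of_odot_eq_zero h h']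

/-- Chang's ordered group of an MV-chain `A`: the lexicographic product of `ℤ` and `A ∖ {1}`,
with addition carrying over into `ℤ`. -/
@[ext]
structure ChangGroup (A : Type*) [MVAlgebra A] where
  level : ℤ
  frac : A
  frac_ne_one : frac ≠ one

namespace ChangGroup

theorem odot_ne_one {x : A} (h : x ≠ one) (y : A) : x ⊙ y ≠ one := fun h' =>
  h (eq_one_of_one_le (h'.symm.trans_le (odot_le_left x y)))

open Classical in
noncomputable instance : Add (ChangGroup A) where
  add p q := if h : p.frac ⊕ₘ q.frac = one
    then ⟨p.level + q.level + 1, p.frac ⊙ q.frac, odot_ne_one p.frac_ne_one _⟩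
    else ⟨p.level + q.level, p.frac ⊕ₘ q.frac, h⟩

open Classical in
theorem level_add (p q : ChangGroup A) :
    (p + q).level = p.level + q.level + if p.frac ⊕ₘ q.frac = one then 1 else 0 := by
  change (dite _ _ _ : ChangGroup A).level = _
  split_ifs <;> simp

open Classical in
theorem frac_add (p q : ChangGroup A) :
    (p + q).frac = if p.frac ⊕ₘ q.frac = one then p.frac ⊙ q.frac else p.frac ⊕ₘ q.frac := by
  change (dite _ _ _ : ChangGroup A).frac = _
  split_ifs <;> simp

theorem add_comm' (p q : ChangGroup A) : p + q = q + p := by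
  ext
  · rw [level_add, level_add, oplus_comm, add_comm p.level]
  · rw [frac_add, frac_add, oplus_comm, odot_comm]

open Classical in
theorem level_add_add [IsMVChain A] (p q r : ChangGroup A) :
    (p + q + r).level = p.level + q.level + r.level +
      if p.frac ⊕ₘ q.frac ⊕ₘ r.frac = one then
        if (p.frac ⊙ q.frac) ⊕ₘ ((p.frac ⊕ₘ q.frac) ⊙ r.frac) = one then 2 else 1
      else 0 := by
  rw [level_add, level_add, frac_add]
  by_cases h : p.frac ⊕ₘ q.frac = one
  · simp only [h, if_true, one_oplus, one_odot]
    split_ifs <;> ring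
  · simp only [h, if_false, odot_eq_zero_of_oplus_ne_one h, zero_oplus]
    have : (p.frac ⊕ₘ q.frac) ⊙ r.frac ≠ one := odot_ne_one h _
    simp only [this, if_false]
    split_ifs <;> ring

open Classical in
theorem frac_add_add [IsMVChain A] (p q r : ChangGroup A) :
    (p + q + r).frac =
      if p.frac ⊕ₘ q.frac ⊕ₘ r.frac = one then
        if (p.frac ⊙ q.frac) ⊕ₘ ((p.frac ⊕ₘ q.frac) ⊙ r.frac) = one then
          p.frac ⊙ q.frac ⊙ r.frac
        else (p.frac ⊙ q.frac) ⊕ₘ ((p.frac ⊕ₘ q.frac) ⊙ r.frac)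
      else p.frac ⊕ₘ q.frac ⊕ₘ r.frac := by
  rw [frac_add, frac_add]
  by_cases h : p.frac ⊕ₘ q.frac = one
  · simp only [h, if_true, one_oplus, one_odot]
  · have : (p.frac ⊕ₘ q.frac) ⊙ r.frac ≠ one := odot_ne_one h _
    simp only [h, if_false, odot_eq_zero_of_oplus_ne_one h, zero_oplus, this]

theorem add_assoc' [IsMVChain A] (p q r : ChangGroup A) : p + q + r = p + (q + r) := by
  have h1 : q.frac ⊕ₘ r.frac ⊕ₘ p.frac = p.frac ⊕ₘ q.frac ⊕ₘ r.frac := by ac_rfl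
  have h2 : q.frac ⊙ r.frac ⊙ p.frac = p.frac ⊙ q.frac ⊙ r.frac := by
    rw [odot_comm, odot_assoc]
  rw [add_comm' p (q + r)]
  ext
  · rw [level_add_add, level_add_add, h1, carry_rotate p.frac]
    ring
  · rw [frac_add_add, frac_add_add, h1, h2, carry_rotate p.frac]

theorem neg_ne_one {x : A} (h : x ≠ zero) : ∼x ≠ one := fun h' =>
  h (by rw [← neg_neg x, h', neg_one])

open Classical in
noncomputable instance [IsMVChain A] : LinearOrder (ChangGroup A) where
  le p q := p.level < q.level ∨ p.level = q.level ∧ p.frac ≤ q.frac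
  le_refl p := Or.inr ⟨rfl, le_rfl⟩
  le_trans p q r := by
    rintro (h | ⟨h, h'⟩) (k | ⟨k, k'⟩)
    · exact Or.inl (h.trans k)
    · exact Or.inl (k ▸ h)
    · exact Or.inl (h ▸ k)
    · exact Or.inr ⟨h.trans k, h'.trans k'⟩
  le_antisymm p q := by
    rintro (h | ⟨h, h'⟩) (k | ⟨k, k'⟩)
    · exact absurd h k.asymm
    · exact absurd k.symm h.ne
    · exact absurd h.symm k.ne
    · exact ChangGroup.ext h (le_antisymm h' k')
  le_total p q := by
    rcases lt_trichotomy p.level q.level with h | h | h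
    · exact Or.inl (Or.inl h)
    · exact (IsMVChain.le_total p.frac q.frac).imp (fun k => Or.inr ⟨h, k⟩)
        fun k => Or.inr ⟨h.symm, k⟩
    · exact Or.inr (Or.inl h)
  toDecidableLE := Classical.decRel _

theorem le_iff [IsMVChain A] {p q : ChangGroup A} :
    p ≤ q ↔ p.level < q.level ∨ p.level = q.level ∧ p.frac ≤ q.frac := Iff.rfl

theorem add_le_add_right' [IsMVChain A] {p q : ChangGroup A} (h : p ≤ q) (r : ChangGroup A) :
    p + r ≤ q + r := by
  rw [le_iff, level_add, level_add, frac_add, frac_add]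
  rcases h with h | ⟨h, h'⟩
  · by_cases hp : p.frac ⊕ₘ r.frac = one <;> by_cases hq : q.frac ⊕ₘ r.frac = one <;>
      simp only [hp, hq, if_true, if_false]
    · left; omega
    · rcases (Int.add_one_le_iff.2 h).lt_or_eq with k | k
      · left; omega
      · right
        exact ⟨by omega, (odot_le_right _ _).trans (le_oplus_right _ _)⟩
    · left; omega
    · left; omega
  · have hm := oplus_le_oplus h' (le_refl r.frac)
    by_cases hp : p.frac ⊕ₘ r.frac = one
    · have hq : q.frac ⊕ₘ r.frac = one := eq_one_of_one_le (hp ▸ hm)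
      simp only [hp, hq, if_true]
      exact Or.inr ⟨by rw [h], odot_le_odot h' le_rfl⟩
    · by_cases hq : q.frac ⊕ₘ r.frac = one <;> simp only [hp, hq, if_true, if_false]
      · left; omega
      · exact Or.inr ⟨by rw [h], hm⟩

variable [Nontrivial A]

theorem zero_ne_one' : (zero : A) ≠ one := fun h => by
  obtain ⟨x, y, hxy⟩ := exists_pair_ne A
  have : ∀ z : A, z = zero := fun z => eq_zero_of_le_zero ((le_one' z).trans_eq h.symm)
  exact hxy ((this x).trans (this y).symm)

instance : Zero (ChangGroup A) := ⟨⟨0, zero, zero_ne_one'⟩⟩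

theorem level_zero : (0 : ChangGroup A).level = 0 := rfl

theorem frac_zero : (0 : ChangGroup A).frac = zero := rfl

theorem zero_add' (p : ChangGroup A) : 0 + p = p := by
  ext
  · simp only [level_add, frac_zero, level_zero, zero_oplus, p.frac_ne_one, if_false]
    ring
  · simp only [frac_add, frac_zero, zero_oplus, p.frac_ne_one, if_false]

-- Since `¬0 = 1` is not an allowed fractional part, only a nonzero fractional part borrows from the
-- level.
open Classical in
noncomputable instance : Neg (ChangGroup A) where
  neg p := if h : p.frac = zero then ⟨-p.level, zero, zero_ne_one'⟩
    else ⟨-p.level - 1, ∼p.frac, neg_ne_one h⟩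

theorem neg_add_cancel' (p : ChangGroup A) : -p + p = 0 := by
  by_cases h : p.frac = zero
  · have hn : -p = ⟨-p.level, zero, zero_ne_one'⟩ := dif_pos h
    ext
    · simp only [level_add, hn, h, level_zero, zero_oplus, zero_ne_one', if_false]
      ring
    · simp only [frac_add, hn, h, frac_zero, zero_oplus, zero_ne_one', if_false]
  · have hn : -p = ⟨-p.level - 1, ∼p.frac, neg_ne_one h⟩ := dif_neg h
    ext
    · simp only [level_add, hn, level_zero, neg_oplus_self, if_true]
      ring
    · simp only [frac_add, hn, frac_zero, neg_oplus_self, if_true]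
      rw [odot_comm, odot_neg_self]

noncomputable instance [IsMVChain A] : AddCommGroup (ChangGroup A) where
  add_assoc := add_assoc'
  zero_add := zero_add'
  add_zero p := by rw [add_comm', zero_add']
  add_comm := add_comm'
  neg_add_cancel := neg_add_cancel'
  nsmul := nsmulRec
  zsmul := zsmulRec

instance [IsMVChain A] : IsOrderedAddMonoid (ChangGroup A) where
  add_le_add_left _ _ h r := add_le_add_right' h r

open Classical in
/-- The embedding of an MV-chain as the unit interval of its Chang group. -/
noncomputable def of (x : A) : ChangGroup A :=
  if h : x = one then ⟨1, zero, zero_ne_one'⟩ else ⟨0, x, h⟩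

theorem of_one : of (one : A) = ⟨1, zero, zero_ne_one'⟩ := dif_pos rfl

theorem of_of_ne {x : A} (h : x ≠ one) : of x = ⟨0, x, h⟩ := dif_neg h

theorem of_zero : of (zero : A) = 0 := of_of_ne zero_ne_one'

theorem of_injective : Function.Injective (of : A → ChangGroup A) := by
  intro x y h
  by_cases hx : x = one <;> by_cases hy : y = one
  · rw [hx, hy]
  · rw [hx, of_one, of_of_ne hy] at h
    exact absurd (congrArg level h) one_ne_zero
  · rw [hy, of_one, of_of_ne hx] at h
    exact absurd (congrArg level h) zero_ne_one
  · rw [of_of_ne hx, of_of_ne hy] at h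
    exact congrArg frac h

variable [IsMVChain A]

theorem of_le_of {x y : A} (h : x ≤ y) : of x ≤ of y := by
  by_cases hy : y = one
  · by_cases hx : x = one
    · rw [hx, hy]
    · rw [hy, of_one, of_of_ne hx]
      exact Or.inl zero_lt_one
  · have hx : x ≠ one := by
      rintro rfl
      exact hy (eq_one_of_one_le h)
    rw [of_of_ne hx, of_of_ne hy]
    exact Or.inr ⟨rfl, h⟩

theorem of_oplus {x y : A} (h : x ⊙ y = zero) : of (x ⊕ₘ y) = of x + of y := by
  by_cases hx : x = one
  · rw [hx, one_odot] at h
    rw [h, oplus_zero, of_zero, add_zero]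
  by_cases hy : y = one
  · rw [hy, odot_one] at h
    rw [h, zero_oplus, of_zero, zero_add]
  rw [of_of_ne hx, of_of_ne hy]
  by_cases hxy : x ⊕ₘ y = one
  · rw [hxy, of_one]
    ext
    · simp [level_add, hxy]
    · simp [frac_add, hxy, h]
  · rw [of_of_ne hxy]
    ext
    · simp [level_add, hxy]
    · simp [frac_add, hxy]

end ChangGroup

end ChangGroup

/-! ### Finite partial embeddings of chains. -/

section PartialEmbedding

attribute [local instance] natOrder

local infixl:70 " ⊙ " => MVAlgebra.odot

variable {A : Type*} [MVAlgebra A] [Nontrivial A] [IsMVChain A]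

theorem exists_rat_strictMonoOn_additive (X : Finset A) (h0 : zero ∈ X) :
    ∃ q : A → ℚ, q zero = 0 ∧ (∀ x ∈ X, ∀ y ∈ X, x ≤ y → x ≠ y → q x < q y) ∧
      ∀ x ∈ X, ∀ y ∈ X, x ⊕ₘ y ∈ X → x ⊙ y = zero → q (x ⊕ₘ y) = q x + q y := by
  classical
  -- Positivity on differences yields strict monotonicity; `zero ∈ X` puts the elements themselves
  -- among the differences.
  let S : Finset (ChangGroup A) := (X ×ˢ X).image fun p => .of p.1 - .of p.2
  have hS : ∀ {x y}, x ∈ X → y ∈ X → ChangGroup.of x - .of y ∈ S := fun hx hy =>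
    Finset.mem_image.2 ⟨(_, _), Finset.mk_mem_product hx hy, rfl⟩
  have hof : ∀ {x}, x ∈ X → ChangGroup.of x ∈ Submodule.span ℤ (S : Set (ChangGroup A)) := by
    intro x hx
    have := hS hx h0
    rw [ChangGroup.of_zero, sub_zero] at this
    exact Submodule.subset_span this
  obtain ⟨h, hh⟩ := exists_linearMap_span_rat_pos S
  let q : A → ℚ := fun x => if hx : x ∈ X then h ⟨.of x, hof hx⟩ else 0
  have hq : ∀ {x} (hx : x ∈ X), q x = h ⟨.of x, hof hx⟩ := fun hx => dif_pos hx
  refine ⟨q, ?_, fun x hx y hy hle hne => ?_, fun x hx y hy hxy hz => ?_⟩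
  · rw [hq h0, ← map_zero h]
    exact congrArg h (Subtype.ext ChangGroup.of_zero)
  · have hlt : ChangGroup.of x < .of y :=
      lt_of_le_of_ne (ChangGroup.of_le_of hle) fun h => hne (ChangGroup.of_injective h)
    have := hh _ (hS hy hx) (sub_pos.2 hlt)
    rw [hq hx, hq hy, ← sub_pos, ← map_sub]
    exact this
  · rw [hq hx, hq hy, hq hxy, ← map_add]
    exact congrArg h (Subtype.ext (ChangGroup.of_oplus hz))

/-- MV-chains are locally embeddable into the unit interval of any ordered field. -/
theorem exists_partial_embedding (K : Type*) [Field K] [LinearOrder K] [IsStrictOrderedRing K]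
    (X : Finset A) :
    ∃ f : A → Set.Icc (0 : K) 1, f zero = zero ∧ Set.InjOn f X ∧
      (∀ x ∈ X, f ∼x = ∼(f x)) ∧
      ∀ x ∈ X, ∀ y ∈ X, x ⊕ₘ y ∈ X → f (x ⊕ₘ y) = f x ⊕ₘ f y := by
  classical
  -- With `1` and the negations included, additivity applies to `x ⊕ ¬x = 1` and determines `q` at
  -- `¬x`.
  let Y := insert zero (insert one (X ∪ X.image neg))
  have h0 : zero ∈ Y := Finset.mem_insert_self _ _
  have h1 : one ∈ Y := Finset.mem_insert_of_mem (Finset.mem_insert_self _ _)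
  have hX : ∀ {x}, x ∈ X → x ∈ Y := fun hx =>
    Finset.mem_insert_of_mem (Finset.mem_insert_of_mem (Finset.mem_union_left _ hx))
  have hN : ∀ {x}, x ∈ X → ∼x ∈ Y := fun hx =>
    Finset.mem_insert_of_mem (Finset.mem_insert_of_mem
      (Finset.mem_union_right _ (Finset.mem_image_of_mem _ hx)))
  obtain ⟨q, q0, qlt, qadd⟩ := exists_rat_strictMonoOn_additive Y h0
  have qle : ∀ {x y}, x ∈ Y → y ∈ Y → x ≤ y → q x ≤ q y := fun {x y} hx hy h => by
    by_cases hxy : x = y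
    · rw [hxy]
    · exact (qlt x hx y hy h hxy).le
  have q1 : 0 < q one := by
    rw [← q0]; exact qlt _ h0 _ h1 (zero_le' _) ChangGroup.zero_ne_one'
  have qneg : ∀ {x}, x ∈ X → q ∼x = q one - q x := fun {x} hx => by
    have := qadd x (hX hx) ∼x (hN hx) (by rwa [oplus_neg_self]) (odot_neg_self x)
    rw [oplus_neg_self] at this
    linarith
  -- Dividing by `q one` sends 1 to 1; the default 0 keeps values off `Y` in the unit interval.
  let g : A → ℚ := fun x => if x ∈ Y then q x / q one else 0
  have hg : ∀ {x}, x ∈ Y → g x = q x / q one := fun hx => if_pos hx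
  have hg01 : ∀ x, 0 ≤ g x ∧ g x ≤ 1 := by
    intro x
    by_cases hx : x ∈ Y
    · rw [hg hx]
      exact ⟨div_nonneg (q0 ▸ qle h0 hx (zero_le' x)) q1.le,
        (div_le_one q1).2 (qle hx h1 (le_one' x))⟩
    · simp [g, hx]
  refine ⟨fun x => ⟨(g x : K), by exact_mod_cast (hg01 x).1, by exact_mod_cast (hg01 x).2⟩,
    ?_, ?_, ?_, ?_⟩
  · refine Subtype.ext ?_
    change (g zero : K) = 0
    rw [hg h0, q0, zero_div, Rat.cast_zero]
  · intro x hx y hy h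
    have h' : g x = g y := Rat.cast_injective (α := K) (congrArg Subtype.val h)
    rw [hg (hX hx), hg (hX hy), div_left_inj' q1.ne'] at h'
    by_contra hne
    rcases IsMVChain.le_total x y with hle | hle
    · exact (qlt x (hX hx) y (hX hy) hle hne).ne h'
    · exact (qlt y (hX hy) x (hX hx) hle (Ne.symm hne)).ne h'.symm
  · intro x hx
    refine Subtype.ext ?_
    change (g ∼x : K) = 1 - (g x : K)
    rw [hg (hX hx), hg (hN hx), qneg hx, sub_div, div_self q1.ne']
    push_cast
    rfl
  · intro x hx y hy hxy
    refine Subtype.ext ?_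
    change (g (x ⊕ₘ y) : K) = min ((g x : K) + (g y : K)) 1
    -- If `x ⊕ y = 1`, then `¬x ≤ y` gives `q one ≤ q x + q y`; otherwise `x ⊙ y = 0` in a chain,
    -- and `q` is additive.
    have key : g (x ⊕ₘ y) = min (g x + g y) 1 := by
      by_cases h : x ⊕ₘ y = one
      · rw [h, hg h1, div_self q1.ne', min_eq_right]
        rw [hg (hX hx), hg (hX hy), ← add_div, one_le_div q1]
        have := qle (hN hx) (hX hy) (oplus_eq_one_iff.1 h)
        rw [qneg hx] at this
        linarith
      · rw [eq_comm, hg (hX hxy), qadd x (hX hx) y (hX hy) (hX hxy)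
          (odot_eq_zero_of_oplus_ne_one h), add_div, ← hg (hX hx), ← hg (hX hy), min_eq_left]
        have := (hg01 (x ⊕ₘ y)).2
        rwa [hg (hX hxy), qadd x (hX hx) y (hX hy) (hX hxy)
          (odot_eq_zero_of_oplus_ne_one h), add_div, ← hg (hX hx), ← hg (hX hy)] at this
    rw [key]
    push_cast
    rfl

end PartialEmbedding

/-! ### Gluing along the ultrafilter. -/

section Gluing

/-- An MV-chain embeds into an ultrapower of the unit interval of any ordered field. -/
theorem exists_embedding_ultrapower {T A : Type*} [MVAlgebra A] [Nontrivial A] [IsMVChain A]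
    (K : Type*) [Field K] [LinearOrder K] [IsStrictOrderedRing K]
    (U : Ultrafilter (Finset T)) (hU : ∀ X : Finset T, {Y | X ⊆ Y} ∈ U)
    {j : A → T} (hj : Function.Injective j) :
    ∃ f : A → Ultrapower U (Set.Icc (0 : K) 1), IsEmbedding f := by
  classical
  choose F hF0 hFinj hFneg hFadd using fun Y : Finset T =>
    exists_partial_embedding K (Y.preimage j hj.injOn)
  have mem : ∀ x : A, ∀ᶠ Y in (U : Filter (Finset T)), x ∈ Y.preimage j hj.injOn := by
    intro x
    refine Filter.mem_of_superset (hU {j x}) fun Y hY => ?_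
    exact Finset.mem_preimage.2 (hY (Finset.mem_singleton_self _))
  refine ⟨fun x => Germ.ofFun fun Y => F Y x, ?_, ?_, ?_, ?_⟩
  · intro x y h
    obtain ⟨Y, hY, hx, hy⟩ := ((Germ.coe_eq.1 h).and ((mem x).and (mem y))).exists
    exact hFinj Y hx hy hY
  · intro x y
    refine Germ.coe_eq.2 ?_
    filter_upwards [mem x, mem y, mem (x ⊕ₘ y)] with Y hx hy hxy
    exact hFadd Y x hx y hy hxy
  · intro x
    refine Germ.coe_eq.2 ?_
    filter_upwards [mem x] with Y hx
    exact hFneg Y x hx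
  · refine Germ.coe_eq.2 ?_
    filter_upwards with Y
    exact hF0 Y

attribute [local instance] natOrder

local infixl:65 " ⊖ " => MVAlgebra.sub

variable {T M : Type*} [MVAlgebra M] (K : Type*) [Field K] [LinearOrder K]
  [IsStrictOrderedRing K] (U : Ultrafilter (Finset T)) (hU : ∀ X : Finset T, {Y | X ⊆ Y} ∈ U)
  {j : M → T} (hj : Function.Injective j)

include hU hj

/-- Pass to the chain quotient by a prime ideal avoiding `a`; a section of the quotient map followed
by `j` injects it into `T`, so the same `U` applies. -/
theorem exists_isHom_ultrapower_ne_zero {a : M} (ha : a ≠ zero) :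
    ∃ f : M → Ultrapower U (Set.Icc (0 : K) 1), IsHom f ∧ f a ≠ zero := by
  obtain ⟨J, hJ, haJ, htot⟩ := exists_prime_ideal ha
  have ha' : hJ.toQuot a ≠ zero := fun h => haJ (hJ.toQuot_eq_zero_iff.1 h)
  have : Nontrivial hJ.Quot := ⟨_, _, ha'⟩
  have : IsMVChain hJ.Quot := ⟨fun x y => by
    obtain ⟨x, rfl⟩ := hJ.toQuot_surjective x
    obtain ⟨y, rfl⟩ := hJ.toQuot_surjective y
    exact (htot x y).imp hJ.toQuot_le_toQuot hJ.toQuot_le_toQuot⟩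
  obtain ⟨f, hf⟩ := exists_embedding_ultrapower K U hU
    (hj.comp (Function.injective_surjInv hJ.toQuot_surjective))
  refine ⟨f ∘ hJ.toQuot, ⟨fun x y => ?_, fun x => ?_, ?_⟩, fun h => ha' ?_⟩
  · exact (congrArg f (hJ.isHom_toQuot.map_oplus x y)).trans (hf.map_oplus _ _)
  · exact (congrArg f (hJ.isHom_toQuot.map_neg x)).trans (hf.map_neg _)
  · exact (congrArg f hJ.isHom_toQuot.map_zero).trans hf.map_zero
  · exact hf.injective (h.trans hf.map_zero.symm)

theorem exists_embedding_fun_ultrapower [Nontrivial M] :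
    ∃ f : M → (Set T → Ultrapower U (Set.Icc (0 : K) 1)), IsEmbedding f := by
  have h : ∀ a : M, ∃ f : M → Ultrapower U (Set.Icc (0 : K) 1),
      IsHom f ∧ (a ≠ zero → f a ≠ zero) := by
    intro a
    by_cases ha : a = zero
    -- At `a = 0` any homomorphism will do; nontriviality provides one.
    · obtain ⟨b, hb⟩ := exists_ne (zero : M)
      obtain ⟨f, hf, -⟩ := exists_isHom_ultrapower_ne_zero K U hU hj hb
      exact ⟨f, hf, fun h => absurd ha h⟩
    · obtain ⟨f, hf, hfa⟩ := exists_isHom_ultrapower_ne_zero K U hU hj ha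
      exact ⟨f, hf, fun _ => hfa⟩
  choose φ hφ hφa using h
  have : Nonempty M := ⟨zero⟩
  have hc : Function.Injective fun a : M => ({j a} : Set T) :=
    fun a b hab => hj (Set.singleton_injective hab)
  -- The coordinate at `{j a}` is `φ a`; subsets not of this form receive an arbitrary `φ b`.
  refine ⟨fun x t => φ (Function.invFun (fun a : M => ({j a} : Set T)) t) x,
    fun x y hxy => ?_, fun x y => funext fun t => (hφ _).map_oplus x y,
    fun x => funext fun t => (hφ _).map_neg x, funext fun t => (hφ _).map_zero⟩
  -- If `x ⊖ y` were nonzero, its own homomorphism would not kill it, yet that map identifies `x`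
  -- and `y`.
  have hle : ∀ {x y : M}, (∀ a, φ a x = φ a y) → x ≤ y := by
    intro x y h
    rw [← sub_eq_zero_iff]
    by_contra hne
    refine hφa _ hne ?_
    rw [(hφ _).map_sub, h]
    exact sub_eq_zero_iff.2 ((natOrder _).le_refl _)
  have heq : ∀ a, φ a x = φ a y := fun a => by
    have := congrFun hxy {j a}
    simpa only [Function.leftInverse_invFun hc a] using this
  exact le_antisymm (hle heq) (hle fun a => (heq a).symm)

end Gluing

end MVAlgebra

/-! ### The ultrafilter of cones and the conclusion. -/

theorem exists_containsCones (α : Cardinal.{u}) :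
    ∃ U : Ultrafilter (FinSubsets α), ContainsCones U := by
  classical
  exact ⟨Ultrafilter.of atTop, fun X => Ultrafilter.of_le atTop (mem_atTop X)⟩

/-- The cones over singletons witness regularity: distinct points give distinct cones, and a finite
`Y` lies in the cone over `{t}` only for `t ∈ Y`. -/
theorem ContainsCones.isRegularFilter {α : Cardinal.{u}} {U : Ultrafilter (FinSubsets α)}
    (hU : ContainsCones U) : IsRegularFilter α (U : Filter (FinSubsets α)) := by
  have hinj : Function.Injective fun t : α.ord.ToType => {Y : FinSubsets α | {t} ⊆ Y} := by
    intro s t h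
    have : ({s} : FinSubsets α) ∈ {Y : FinSubsets α | {t} ⊆ Y} := by
      rw [← show {Y : FinSubsets α | {s} ⊆ Y} = {Y : FinSubsets α | {t} ⊆ Y} from h]
      exact Finset.Subset.refl _
    exact (Finset.singleton_subset_singleton.1 this).symm
  refine ⟨U.neBot, Set.range fun t : α.ord.ToType => {Y : FinSubsets α | {t} ⊆ Y}, ?_, ?_, ?_⟩
  · rintro _ ⟨t, rfl⟩
    exact hU {t}
  · rw [mk_range_eq _ hinj, mk_ord_toType]
  · intro Y
    refine (Y.finite_toSet.image fun t => {Z : FinSubsets α | {t} ⊆ Z}).subset ?_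
    rintro _ ⟨⟨t, rfl⟩, hY⟩
    exact ⟨t, Finset.singleton_subset_iff.1 hY, rfl⟩

theorem theorem11 (α : Cardinal.{u}) (hα : ℵ₀ ≤ α) :
    (∃ U : Ultrafilter (FinSubsets α), ContainsCones U) ∧
    ∀ U : Ultrafilter (FinSubsets α), ContainsCones U →
      IsRegularFilter α (U : Filter (FinSubsets α)) ∧
      ∀ (M : Type v) [MVAlgebra M] [Nontrivial M],
        Cardinal.lift.{u} #M ≤ Cardinal.lift.{v} α →
          (∃ f : M → (Set α.ord.ToType → MVAlgebra.Ultrapower U (Set.Icc (0 : ℚ) 1)),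
            MVAlgebra.IsEmbedding f) ∧
          (∃ f : M → (Set α.ord.ToType → MVAlgebra.Ultrapower U (Set.Icc (0 : ℝ) 1)),
            MVAlgebra.IsEmbedding f) := by
  refine ⟨exists_containsCones α, fun U hU => ⟨hU.isRegularFilter, fun M _ _ hM => ?_⟩⟩
  rw [← mk_ord_toType α, lift_mk_le'] at hM
  obtain ⟨j⟩ := hM
  exact ⟨MVAlgebra.exists_embedding_fun_ultrapower ℚ U hU j.injective,
    MVAlgebra.exists_embedding_fun_ultrapower ℝ U hU j.injective⟩
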